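/- Write $\lceil z\rfloor^{q}=|z|^{q}\,\mathrm{sign}(z)$ for real $z$ and $q>0$, and apply $\lceil\cdot\rfloor^{q}$ and $\tanh$ to vectors componentwise. **Plant.** Consider the Euler–Lagrange system $M(q)\ddot q+C(q,\dot q)\dot q+\nabla\mathcal U(q)=\tau$ with $q(t)\in\mathbb R^n$, where $M(q)=\sum_k M_k(q)\theta_{Mk}$ and $\mathcal U(q)=\sum_{k=1}^{\jmath}\mathcal U_k(q)\theta_{Uk}$ with constant parameters $\theta_M,\theta_U$. The functions $M_k,\mathcal U_k$ are smooth and uniformly bounded, and the gradients $\nabla\mathcal U_k$ are uniformly bounded. The matrix $M(q)$ is symmetric with $\mu_m I\le M(q)\le\mu_M I$ for all $q$, for some $\mu_m,\mu_M>0$. The matrix $C(q,\dot q)$ is defined through the Christoffel symbols of the first kind of $M$. Let $\Psi(q)\in\mathbb R^{n\times\jmath}$ be the matrix with columns $\nabla\mathcal U_k(q)$. **Gains.** Let $P,D,D_L\in\mathbb R^{n\times n}$ and $\Gamma,\Upsilon_U\in\mathbb R^{\jmath\times\jmath}$ be diagonal and positive definite, let $2r_2>r_1>r_2>0$, $a=(2r_2-r_1)/r_1$,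 $b=(2r_2-r_1)/r_2$, let $d,\gamma_1,\gamma_2>0$, and let $0<d_1\le\lambda_{\min}(D_L)\,\mu_m/\mu_M^2$. Put $f(\Delta)=\lceil\Delta\rfloor^{d}/(1+|\Delta|^{b+d})$ and $\zeta_1(\Delta)=f(\Delta)\lceil\Delta\rfloor^{b}$. Let $q_d\in\mathbb R^n$ be arbitrary, and let $\Delta:[0,\infty)\to\mathbb R$ be any continuous function. **Claim 1.** Let $(e_1,e_2,\tilde\theta_U)$, with $q=e_1+q_d$ and arbitrary initial condition, be a solution on $[0,\infty)$ of the closed-loop system $$\dot e_1=e_2,$$ $$\dot e_2=M(q)^{-1}\big[-P\lceil e_1\rfloor^{a}-D\lceil e_2\rfloor^{b}-D_Le_2-C(q,e_2)e_2+\Psi(q)\tilde\theta_U\big],$$ $$\dot{\tilde\theta}_U=-\Gamma\Psi(q)^{\top}\big[\gamma_1d_1\tanh(e_1)+(\gamma_1+\gamma_2)e_2\big]-(\gamma_1+\gamma_2)\,\Gamma\Upsilon_U\,\zeta_1(\Delta(t))\lceil\tilde\theta_U\rfloor^{b}.$$ If there exists $T_\theta>0$ such that $\Psi(q(t))\tilde\theta_U(t)=0$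 for all $t\ge T_\theta$, then there exists $T_e\ge T_\theta$ such that $e_1(t)=e_2(t)=0$ for all $t\ge T_e$. **Claim 2 (known parameters).** For every solution $(e_1,e_2)$ on $[0,\infty)$ of the system formed by the first two equations with $\tilde\theta_U\equiv0$, there exists $T_e\ge0$ such that $e_1(t)=e_2(t)=0$ for all $t\ge T_e$. -/

import Mathlib

open scoped Matrix ContDiff

noncomputable section

namespace FTPD

/-- The signed power `⌈z⌋^q = |z|^q sign z` of a real number. -/
def spow (q z : ℝ) : ℝ := |z| ^ q * Real.sign z

/-- The componentwise signed power of a vector. -/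
def vspow {m : ℕ} (q : ℝ) (z : Fin m → ℝ) : Fin m → ℝ := fun i => spow q (z i)

/-- The partial derivative `∂f/∂q_k` at `q`. -/
def partialDeriv {n : ℕ} (f : (Fin n → ℝ) → ℝ) (k : Fin n) (q : Fin n → ℝ) : ℝ :=
  fderiv ℝ f q (Pi.single k 1)

/-- The data of a fully actuated Euler-Lagrange system with `n` degrees of freedom whose inertia
matrix and potential energy are linearly parameterized, by `ι` and `κ` parameters respectively. -/
structure Plant (n ι κ : ℕ) where
  /-- the matrices `M_k(q)` -/
  Mk : Fin ι → (Fin n → ℝ) → Matrix (Fin n) (Fin n) ℝ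
  /-- the scalar functions `𝒰_k(q)` -/
  Uk : Fin κ → (Fin n → ℝ) → ℝ
  /-- the inertial parameters -/
  θM : Fin ι → ℝ
  /-- the potential-energy parameters -/
  θU : Fin κ → ℝ

namespace Plant

variable {n ι κ : ℕ} (S : Plant n ι κ)

/-- The inertia matrix `M(q) = ∑ M_k(q) θ_{Mk}`. -/
def M (q : Fin n → ℝ) : Matrix (Fin n) (Fin n) ℝ := ∑ k, S.θM k • S.Mk k q

/-- The Christoffel symbol of the first kind
`c_{ijk} = (∂_i M_{kj} + ∂_j M_{ki} - ∂_k M_{ij}) / 2`. -/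
def christoffel (i j k : Fin n) (q : Fin n → ℝ) : ℝ :=
  (partialDeriv (fun x => S.M x k j) i q + partialDeriv (fun x => S.M x k i) j q
    - partialDeriv (fun x => S.M x i j) k q) / 2

/-- The matrix of Coriolis and centrifugal forces, `C(q, v)_{kj} = ∑_i c_{ijk}(q) v_i`. -/
def C (q v : Fin n → ℝ) : Matrix (Fin n) (Fin n) ℝ :=
  Matrix.of fun k j => ∑ i, S.christoffel i j k q * v i

/-- The regressor `Ψ(q)`, whose `k`-th column is `∇𝒰_k(q)`; thus the potential-energy force is
`g(q) = Ψ(q) θ_U`. -/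
def Ψ (q : Fin n → ℝ) : Matrix (Fin n) (Fin κ) ℝ :=
  Matrix.of fun i k => partialDeriv (S.Uk k) i q

/-- The standing assumptions on the plant: `M_k` and `𝒰_k` are smooth and uniformly bounded,
`∇𝒰_k` is uniformly bounded (it is locally Lipschitz by smoothness), and `M(q)` is a symmetric
matrix with `μm I ≤ M(q) ≤ μM I` for all `q`, where `μm, μM > 0`. -/
structure Standing (μm μM : ℝ) : Prop where
  Mk_smooth : ∀ k i j, ContDiff ℝ ∞ (fun q => S.Mk k q i j)
  Mk_bounded : ∀ k i j, ∃ B : ℝ, ∀ q, |S.Mk k q i j| ≤ B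
  Uk_smooth : ∀ k, ContDiff ℝ ∞ (S.Uk k)
  Uk_bounded : ∀ k, ∃ B : ℝ, ∀ q, |S.Uk k q| ≤ B
  gradUk_bounded : ∀ k i, ∃ B : ℝ, ∀ q, |partialDeriv (S.Uk k) i q| ≤ B
  M_symm : ∀ q, (S.M q).IsSymm
  μm_pos : 0 < μm
  μM_pos : 0 < μM
  M_lower : ∀ q v, μm * (v ⬝ᵥ v) ≤ v ⬝ᵥ (S.M q *ᵥ v)
  M_upper : ∀ q v, v ⬝ᵥ (S.M q *ᵥ v) ≤ μM * (v ⬝ᵥ v)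

end Plant

/-- The design parameters of the controller and of the adaptation law. The diagonal gain matrices
`P, D, D_L, Γ, Υ_U` are given by their diagonals `p, d, dL, Γ, Υ`; `δ` is the exponent `d` of the
saturation function `f`. -/
structure Gains (n κ : ℕ) where
  p : Fin n → ℝ
  d : Fin n → ℝ
  dL : Fin n → ℝ
  Γ : Fin κ → ℝ
  Υ : Fin κ → ℝ
  r₁ : ℝ
  r₂ : ℝ
  δ : ℝ
  d₁ : ℝ
  γ₁ : ℝ
  γ₂ : ℝ

namespace Gains

variable {n κ : ℕ} (K : Gains n κ)

/-- `m_c = 2 r₂ - r₁`. -/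
def mc : ℝ := 2 * K.r₂ - K.r₁

/-- The exponent `a = m_c / r₁`. -/
def a : ℝ := K.mc / K.r₁

/-- The exponent `b = m_c / r₂`. -/
def b : ℝ := K.mc / K.r₂

/-- The saturation `f(Δ) = ⌈Δ⌋^δ / (1 + |Δ|^{c+δ})` with `c = b`. -/
def f (Δ : ℝ) : ℝ := spow K.δ Δ / (1 + |Δ| ^ (K.b + K.δ))

/-- `ζ₁(Δ) = f(Δ) ⌈Δ⌋^b`. -/
def ζ₁ (Δ : ℝ) : ℝ := K.f Δ * spow K.b Δ

/-- The gain matrices are diagonal and positive definite, `2 r₂ > r₁ > r₂ > 0`, and the scalar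
parameters are positive. -/
structure Admissible : Prop where
  p_pos : ∀ i, 0 < K.p i
  d_pos : ∀ i, 0 < K.d i
  dL_pos : ∀ i, 0 < K.dL i
  Γ_pos : ∀ k, 0 < K.Γ k
  Υ_pos : ∀ k, 0 < K.Υ k
  r₂_pos : 0 < K.r₂
  r₂_lt_r₁ : K.r₂ < K.r₁
  r₁_lt : K.r₁ < 2 * K.r₂
  δ_pos : 0 < K.δ
  d₁_pos : 0 < K.d₁
  γ₁_pos : 0 < K.γ₁
  γ₂_pos : 0 < K.γ₂

end Gains

variable {n ι κ : ℕ}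

/-- The acceleration produced by the finite-time PD controller when the compensation of the
potential forces leaves the residual force `w`:
`M(q)⁻¹ [-P⌈e₁⌋^a - D⌈e₂⌋^b - D_L e₂ - C(q, e₂) e₂ + w]` with `q = e₁ + q_d`. -/
def accel (S : Plant n ι κ) (K : Gains n κ) (qd e₁ e₂ w : Fin n → ℝ) : Fin n → ℝ :=
  (S.M (e₁ + qd))⁻¹ *ᵥ
    (-(Matrix.diagonal K.p *ᵥ vspow K.a e₁) - Matrix.diagonal K.d *ᵥ vspow K.b e₂
      - Matrix.diagonal K.dL *ᵥ e₂ - S.C (e₁ + qd) e₂ *ᵥ e₂ + w)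

/-- The composite adaptation law in terms of the estimation error `θ = θ̂_U - θ_U`:
`-Γ Ψ(q)ᵀ [γ₁ d₁ tanh e₁ + (γ₁ + γ₂) e₂] - (γ₁ + γ₂) Γ Υ_U ζ₁(Δ) ⌈θ⌋^b`. -/
def adaptation (S : Plant n ι κ) (K : Gains n κ) (qd : Fin n → ℝ) (Δ : ℝ)
    (e₁ e₂ : Fin n → ℝ) (θ : Fin κ → ℝ) : Fin κ → ℝ :=
  -(Matrix.diagonal K.Γ *ᵥ ((S.Ψ (e₁ + qd))ᵀ *ᵥ
      ((K.γ₁ * K.d₁) • (fun i => Real.tanh (e₁ i)) + (K.γ₁ + K.γ₂) • e₂)))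
    - ((K.γ₁ + K.γ₂) * K.ζ₁ Δ) •
      (Matrix.diagonal K.Γ *ᵥ (Matrix.diagonal K.Υ *ᵥ vspow K.b θ))

/-- `(e₁, e₂, θ)` is a solution on `[0, ∞)` of the adaptive closed loop with set-point `qd`, where
`Δ` is the scalar regressor as a function of time. -/
structure IsClosedLoopSolution (S : Plant n ι κ) (K : Gains n κ) (qd : Fin n → ℝ) (Δ : ℝ → ℝ)
    (e₁ e₂ : ℝ → Fin n → ℝ) (θ : ℝ → Fin κ → ℝ) : Prop where
  deriv_e₁ : ∀ t, 0 ≤ t → HasDerivWithinAt e₁ (e₂ t) (Set.Ici 0) t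
  deriv_e₂ : ∀ t, 0 ≤ t → HasDerivWithinAt e₂
    (accel S K qd (e₁ t) (e₂ t) (S.Ψ (e₁ t + qd) *ᵥ θ t)) (Set.Ici 0) t
  deriv_θ : ∀ t, 0 ≤ t → HasDerivWithinAt θ
    (adaptation S K qd (Δ t) (e₁ t) (e₂ t) (θ t)) (Set.Ici 0) t

/-- `(e₁, e₂)` is a solution on `[0, ∞)` of the closed loop with known parameters, in which the
potential forces are compensated exactly and there is no adaptation. -/
structure IsNominalSolution (S : Plant n ι κ) (K : Gains n κ) (qd : Fin n → ℝ)
    (e₁ e₂ : ℝ → Fin n → ℝ) : Prop where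
  deriv_e₁ : ∀ t, 0 ≤ t → HasDerivWithinAt e₁ (e₂ t) (Set.Ici 0) t
  deriv_e₂ : ∀ t, 0 ≤ t → HasDerivWithinAt e₂ (accel S K qd (e₁ t) (e₂ t) 0) (Set.Ici 0) t

end FTPD

end

namespace FTPD

/-! ### Finite-time convergence of scalar functions -/

/-! Once the residual force `Ψ θ` vanishes, the errors obey the known-parameter equations, so both
claims follow from `exists_forall_ge_eq_zero_of_solvesAt`. The energy `E` is nonincreasing, but its
derivative contains only velocities. A strict Lyapunov function is `V = E ^ s + ε x ⬝ᵥ M v`, with `s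
= 1 + (1 - b) / 2`. Give `x` weight `r₁` and `v` weight `r₂`: then `E` is comparable to a function
of degree `2 r₂`, and both terms of `V` scale with degree `r₁ + r₂`. The factor `E ^ (s - 1)` turns
the dissipation `|v| ^ (b + 1)` into `v ^ 2`, while the cross term supplies `-|x| ^ (a + 1)`.
Coriolis forces and linear damping have higher degree and are controlled on the sublevel set of `E`
fixed by the initial data; its monotonicity keeps the trajectory there. For small `ε`,
`exists_lyapunov_constants` gives `V' ≤ -c E` with `V` comparable to `E ^ s`. Hence `V' ≤ -c' V ^ (1
/ s)` with `1 / s < 1`, which forces extinction in finite time. -/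

theorem antitoneOn_Ici_of_hasDerivAt_nonpos {V V' : ℝ → ℝ} {T₀ : ℝ}
    (hcont : ContinuousOn V (Set.Ici T₀)) (hd : ∀ t, T₀ < t → HasDerivAt V (V' t) t)
    (hle : ∀ t, T₀ < t → V' t ≤ 0) : AntitoneOn V (Set.Ici T₀) := by
  refine antitoneOn_of_hasDerivWithinAt_nonpos (convex_Ici T₀) (f' := V') hcont ?_ ?_
  · intro t ht
    rw [interior_Ici] at ht
    exact (hd t ht).hasDerivWithinAt
  · intro t ht
    rw [interior_Ici] at ht
    exact hle t ht

/-- A nonnegative function with `V' ≤ -c V ^ α`, `0 < α < 1`, vanishes after a finite time. -/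
theorem exists_forall_ge_eq_zero_of_deriv_le_neg_rpow {V V' : ℝ → ℝ} {T₀ c α : ℝ} (hc : 0 < c)
    (hα : α < 1) (hcont : ContinuousOn V (Set.Ici T₀))
    (hd : ∀ t, T₀ < t → HasDerivAt V (V' t) t) (h0 : ∀ t, T₀ ≤ t → 0 ≤ V t)
    (hle : ∀ t, T₀ < t → V' t ≤ -(c * V t ^ α)) :
    ∃ T₁, T₀ ≤ T₁ ∧ ∀ t, T₁ ≤ t → V t = 0 := by
  have hanti : AntitoneOn V (Set.Ici T₀) := by
    refine antitoneOn_Ici_of_hasDerivAt_nonpos hcont hd fun t ht => (hle t ht).trans ?_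
    have := Real.rpow_nonneg (h0 t ht.le) α
    nlinarith
  by_cases hex : ∃ T₁, T₀ ≤ T₁ ∧ V T₁ = 0
  · obtain ⟨T₁, hT, hV⟩ := hex
    refine ⟨T₁, hT, fun t ht => le_antisymm ?_ (h0 t (hT.trans ht))⟩
    exact hV ▸ hanti hT (Set.mem_Ici.2 (hT.trans ht)) ht
  · exfalso
    push Not at hex
    have hpos : ∀ t, T₀ ≤ t → 0 < V t := fun t ht => (h0 t ht).lt_of_ne' (hex t ht)
    have hk : 0 < c * (1 - α) := mul_pos hc (by linarith)
    -- If `V` never vanished, `V ^ (1 - α)` would decrease at rate at least `c (1 - α)`; it would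
    -- have to reach zero by the time used below.
    have hg : AntitoneOn (fun t => V t ^ (1 - α) + c * (1 - α) * t) (Set.Ici T₀) := by
      refine antitoneOn_Ici_of_hasDerivAt_nonpos
        (V' := fun t => V' t * (1 - α) * V t ^ (1 - α - 1) + c * (1 - α) * 1) ?_ ?_ ?_
      · exact (hcont.rpow_const fun t ht => Or.inl (hpos t ht).ne').add (by fun_prop)
      · intro t ht
        exact ((hd t ht).rpow_const (Or.inl (hpos t ht.le).ne')).add
          ((hasDerivAt_id t).const_mul _)
      · intro t ht
        have hV := hpos t ht.le
        have h1 : V t ^ α * V t ^ (1 - α - 1) = 1 := by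
          rw [← Real.rpow_add hV]; ring_nf; exact Real.rpow_zero _
        have h2 : 0 ≤ (1 - α) * V t ^ (1 - α - 1) :=
          mul_nonneg (by linarith) (Real.rpow_nonneg hV.le _)
        have h3 := mul_le_mul_of_nonneg_right (hle t ht) h2
        have h4 : -(c * V t ^ α) * ((1 - α) * V t ^ (1 - α - 1)) = -(c * (1 - α)) := by
          linear_combination -(c * (1 - α)) * h1
        linarith
    have hV0 : 0 ≤ V T₀ ^ (1 - α) := Real.rpow_nonneg (h0 T₀ le_rfl) _
    have hT : T₀ ≤ T₀ + V T₀ ^ (1 - α) / (c * (1 - α)) := by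
      have := div_nonneg hV0 hk.le
      linarith
    have h := hg (Set.mem_Ici.2 le_rfl) (Set.mem_Ici.2 hT) hT
    have hT' := Real.rpow_pos_of_pos (hpos _ hT) (1 - α)
    simp only [mul_add, mul_div_cancel₀ _ hk.ne'] at h
    linarith

/-! ### Signed powers -/

theorem mul_spow_self {q : ℝ} (hq : 0 < q) (z : ℝ) : z * spow q z = |z| ^ (q + 1) := by
  have h : z * Real.sign z = |z| := by
    rcases lt_trichotomy z 0 with h | rfl | h
    · rw [Real.sign_of_neg h, abs_of_neg h]; ring
    · simp
    · rw [Real.sign_of_pos h, abs_of_pos h]; ring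
  rw [Real.rpow_add_one' (abs_nonneg z) (by linarith), spow, ← h]
  ring

theorem abs_spow {q : ℝ} (hq : 0 < q) (z : ℝ) : |spow q z| = |z| ^ q := by
  rcases lt_trichotomy z 0 with h | rfl | h
  · rw [spow, Real.sign_of_neg h]; simp [abs_of_nonneg (Real.rpow_nonneg (abs_nonneg z) q)]
  · simp [spow, Real.zero_rpow hq.ne']
  · rw [spow, Real.sign_of_pos h]; simp [abs_of_nonneg (Real.rpow_nonneg (abs_nonneg z) q)]

theorem hasDerivAt_abs_rpow_add_one {q : ℝ} (hq : 0 < q) (z : ℝ) :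
    HasDerivAt (fun x : ℝ => |x| ^ (q + 1)) ((q + 1) * spow q z) z := by
  convert hasDerivAt_abs_rpow z (p := q + 1) (by linarith) using 1
  rcases eq_or_ne z 0 with rfl | hz
  · simp [spow]
  · have h := mul_spow_self hq z
    have h2 : |z| ^ (q + 1) = |z| ^ (q + 1 - 2) * z ^ 2 := by
      rw [← sq_abs, ← Real.rpow_natCast, ← Real.rpow_add (abs_pos.2 hz)]
      norm_num
    have : spow q z = |z| ^ (q + 1 - 2) * z := by
      apply mul_left_cancel₀ hz
      rw [h, h2]; ring
    rw [this]; ring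

/-! ### Homogeneous inequalities -/

/-- A Young-type inequality, by cases: either `K v ^ b ≤ η x ^ a`, and the first term suffices, or
`x` is at most a multiple of `v ^ (b / a)`. -/
theorem exists_mul_rpow_le {a b : ℝ} (ha : 0 < a) (K : ℝ) {η : ℝ} (hK : 0 ≤ K) (hη : 0 < η) :
    ∃ C, 0 ≤ C ∧ ∀ x v : ℝ, 0 ≤ x → 0 ≤ v →
      K * (x * v ^ b) ≤ η * x ^ (a + 1) + C * (v ^ (b / a) * v ^ b) := by
  refine ⟨K * (K / η) ^ a⁻¹, by positivity, fun x v hx hv => ?_⟩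
  have hxa : x ^ (a + 1) = x ^ a * x := Real.rpow_add_one' hx (by linarith)
  have hvb := Real.rpow_nonneg hv b
  rcases le_total (K * v ^ b) (η * x ^ a) with h | h
  · have h1 := mul_le_mul_of_nonneg_right h hx
    have h2 : 0 ≤ K * (K / η) ^ a⁻¹ * (v ^ (b / a) * v ^ b) := by positivity
    rw [hxa]; linarith
  · have h1 : x ≤ (K / η) ^ a⁻¹ * v ^ (b / a) := by
      have : x ^ a ≤ K / η * v ^ b := by
        rw [div_mul_eq_mul_div, le_div_iff₀ hη]; linarith
      have h2 := Real.rpow_le_rpow (Real.rpow_nonneg hx a) this (inv_nonneg.2 ha.le)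
      rwa [Real.rpow_rpow_inv hx ha.ne', Real.mul_rpow (by positivity) hvb, ← Real.rpow_mul hv,
        ← div_eq_mul_inv b a] at h2
    have h2 := mul_le_mul_of_nonneg_left h1 (mul_nonneg hK hvb)
    have h3 : 0 ≤ η * x ^ (a + 1) := by positivity
    linarith

/-- Split `v ^ 2 = |v| ^ (1 - b) * |v| ^ (b + 1)` and bound the first factor by the energy. This is
how sublinear damping, weighted by a power of `E`, controls the kinetic term. -/
theorem rpow_mul_sq_le {m E b v : ℝ} (hm : 0 < m) (hb0 : 0 < b) (hb : b < 1)
    (h : m * v ^ 2 ≤ E) :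
    m ^ ((1 - b) / 2) * v ^ 2 ≤ E ^ ((1 - b) / 2) * |v| ^ (b + 1) := by
  have h1 := Real.rpow_le_rpow (by positivity) h (by linarith : 0 ≤ (1 - b) / 2)
  have h2 : (v ^ 2) ^ ((1 - b) / 2) = |v| ^ (1 - b) := by
    rw [← sq_abs, ← Real.rpow_natCast, ← Real.rpow_mul (abs_nonneg v)]
    congr 1; push_cast; ring
  have h3 : |v| ^ (1 - b) * |v| ^ (b + 1) = v ^ 2 := by
    rw [← Real.rpow_add_of_nonneg (abs_nonneg v) (by linarith) (by linarith), ← sq_abs,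
      ← Real.rpow_natCast]
    congr 1; push_cast; ring
  rw [Real.mul_rpow hm.le (sq_nonneg v), h2] at h1
  have h4 := mul_le_mul_of_nonneg_right h1 (Real.rpow_nonneg (abs_nonneg v) (b + 1))
  rwa [mul_assoc, h3] at h4

theorem abs_mul_abs_le_rpow {m E a x v : ℝ} (hm : 0 < m) (ha : 0 < a)
    (hx : m * |x| ^ (a + 1) ≤ E) (hv : m * v ^ 2 ≤ E) :
    |x| * |v| ≤ (E / m) ^ ((a + 1)⁻¹ + 2⁻¹) := by
  have hE : 0 ≤ E / m := div_nonneg (le_trans (by positivity) hv) hm.le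
  rw [Real.rpow_add_of_nonneg hE (by positivity) (by norm_num)]
  refine mul_le_mul ?_ ?_ (abs_nonneg v) (Real.rpow_nonneg hE _)
  · have h : |x| ^ (a + 1) ≤ E / m := by rw [le_div_iff₀ hm]; linarith
    have := Real.rpow_le_rpow (by positivity) h (by positivity : 0 ≤ (a + 1)⁻¹)
    rwa [Real.rpow_rpow_inv (abs_nonneg x) (by linarith)] at this
  · have h : v ^ 2 ≤ E / m := by rw [le_div_iff₀ hm]; linarith
    have := Real.sqrt_le_sqrt h
    rwa [Real.sqrt_sq_eq_abs, Real.sqrt_eq_rpow, one_div] at this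

variable {n ι κ : ℕ}

/-! ### The inertia matrix along a trajectory -/

theorem Plant.Standing.contDiff_M {S : Plant n ι κ} {μm μM : ℝ} (hS : S.Standing μm μM)
    (i j : Fin n) : ContDiff ℝ ∞ (fun q => S.M q i j) := by
  have : (fun q => S.M q i j) = fun q => ∑ k, S.θM k * S.Mk k q i j := by
    funext q
    simp [Plant.M, Matrix.sum_apply]
  rw [this]
  exact ContDiff.sum fun k _ => contDiff_const.mul (hS.Mk_smooth k i j)

theorem Plant.Standing.continuous_christoffel {S : Plant n ι κ} {μm μM : ℝ}
    (hS : S.Standing μm μM) (i j k : Fin n) : Continuous (S.christoffel i j k) := by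
  have h : ∀ i j k, Continuous (partialDeriv (fun x => S.M x i j) k) := fun i j k =>
    ((hS.contDiff_M i j).continuous_fderiv (by simp)).clm_apply continuous_const
  exact (((h k j i).add (h k i j)).sub (h i j k)).div_const 2

theorem fderiv_eq_sum_partialDeriv (f : (Fin n → ℝ) → ℝ) (q v : Fin n → ℝ) :
    fderiv ℝ f q v = ∑ i, partialDeriv f i q * v i := by
  conv_lhs => rw [pi_eq_sum_univ' v]
  rw [map_sum]
  refine Finset.sum_congr rfl fun i _ => ?_
  rw [map_smul, partialDeriv, smul_eq_mul, mul_comm]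

/-- Along a trajectory, `Ṁ = C + Cᵀ`. -/
theorem Plant.Standing.hasDerivAt_M {S : Plant n ι κ} {μm μM : ℝ} (hS : S.Standing μm μM)
    {q : ℝ → Fin n → ℝ} {v : Fin n → ℝ} {t : ℝ} (hq : HasDerivAt q v t) (k j : Fin n) :
    HasDerivAt (fun s => S.M (q s) k j) ((S.C (q t) v + (S.C (q t) v)ᵀ) k j) t := by
  have hsymm : ∀ i j, (fun x => S.M x i j) = fun x => S.M x j i := fun i j =>
    funext fun x => (hS.M_symm x).apply j i
  have h := (((hS.contDiff_M k j).differentiable (by simp)) (q t)).hasFDerivAt.comp_hasDerivAt t hq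
  rw [fderiv_eq_sum_partialDeriv] at h
  refine h.congr_deriv ?_
  simp only [Plant.C, Plant.christoffel, Matrix.add_apply, Matrix.transpose_apply, Matrix.of_apply]
  rw [← Finset.sum_add_distrib]
  refine Finset.sum_congr rfl fun i _ => ?_
  -- By symmetry of `M`, the derivatives in directions `j` and `k` cancel between `C` and its
  -- transpose, leaving the one in direction `i`.
  rw [hsymm j k, hsymm i j, hsymm k i]
  ring

theorem Plant.Standing.isUnit_det_M {S : Plant n ι κ} {μm μM : ℝ} (hS : S.Standing μm μM)
    (q : Fin n → ℝ) : IsUnit (S.M q).det := by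
  rw [isUnit_iff_ne_zero]
  intro h
  obtain ⟨v, hv, h0⟩ := Matrix.exists_mulVec_eq_zero_iff.2 h
  have h1 := hS.M_lower q v
  rw [h0, dotProduct_zero] at h1
  have h2 : 0 ≤ v ⬝ᵥ v := Finset.sum_nonneg fun i _ => mul_self_nonneg (v i)
  have h3 : v ⬝ᵥ v = 0 := le_antisymm (by nlinarith [hS.μm_pos]) h2
  exact hv (dotProduct_self_eq_zero.1 h3)

/-- The nonlinear proportional-derivative force together with the linear damping. -/
noncomputable def pdForce (K : Gains n κ) (x v : Fin n → ℝ) : Fin n → ℝ := fun i =>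
  -(K.p i * spow K.a (x i)) - K.d i * spow K.b (v i) - K.dL i * v i

theorem Plant.Standing.M_mulVec_accel {S : Plant n ι κ} {μm μM : ℝ} (hS : S.Standing μm μM)
    (K : Gains n κ) (qd x v : Fin n → ℝ) :
    S.M (x + qd) *ᵥ accel S K qd x v 0 = pdForce K x v - S.C (x + qd) v *ᵥ v := by
  rw [accel, Matrix.mulVec_mulVec, Matrix.mul_nonsing_inv _ (hS.isUnit_det_M _), Matrix.one_mulVec]
  funext i
  simp only [pdForce, vspow, Matrix.mulVec_diagonal, Pi.sub_apply, Pi.add_apply, Pi.neg_apply,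
    Pi.zero_apply]
  ring

/-- A pair of error signals that satisfies the closed-loop equations with known parameters at
the time `t`. -/
structure SolvesAt (S : Plant n ι κ) (K : Gains n κ) (qd : Fin n → ℝ) (x v : ℝ → Fin n → ℝ)
    (t : ℝ) : Prop where
  pos : HasDerivAt x (v t) t
  vel : HasDerivAt v (accel S K qd (x t) (v t) 0) t

/-- In `Ṁ v + M v̇ = (C + Cᵀ) v + (F - C v)` the terms `C v` cancel. Working with the momentum
avoids the inverse of `M`. -/
theorem SolvesAt.hasDerivAt_momentum {S : Plant n ι κ} {K : Gains n κ} {μm μM : ℝ}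
    {qd : Fin n → ℝ} {x v : ℝ → Fin n → ℝ} {t : ℝ} (h : SolvesAt S K qd x v t)
    (hS : S.Standing μm μM) (i : Fin n) :
    HasDerivAt (fun s => (S.M (x s + qd) *ᵥ v s) i)
      (((S.C (x t + qd) (v t))ᵀ *ᵥ v t + pdForce K (x t) (v t)) i) t := by
  have hq : HasDerivAt (fun s => x s + qd) (v t) t := h.pos.add_const qd
  have h1 : HasDerivAt (fun s => ∑ j, S.M (x s + qd) i j * v s j)
      (∑ j, ((S.C (x t + qd) (v t) + (S.C (x t + qd) (v t))ᵀ) i j * v t j +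
        S.M (x t + qd) i j * accel S K qd (x t) (v t) 0 j)) t :=
    HasDerivAt.fun_sum fun j _ => (hS.hasDerivAt_M hq i j).mul (hasDerivAt_pi.1 h.vel j)
  refine h1.congr_deriv ?_
  have h2 := congrFun (hS.M_mulVec_accel K qd (x t) (v t)) i
  rw [Finset.sum_add_distrib]
  change ((S.C (x t + qd) (v t) + (S.C (x t + qd) (v t))ᵀ) *ᵥ v t) i +
    (S.M (x t + qd) *ᵥ accel S K qd (x t) (v t) 0) i = _
  rw [h2, Matrix.add_mulVec]
  simp only [Pi.add_apply, Pi.sub_apply]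
  ring

/-! ### The energy and the cross term -/

/-- Kinetic energy plus the artificial potential of the proportional action. -/
noncomputable def energy (S : Plant n ι κ) (K : Gains n κ) (qd x v : Fin n → ℝ) : ℝ :=
  2⁻¹ * (v ⬝ᵥ S.M (x + qd) *ᵥ v) + ∑ i, K.p i * (K.a + 1)⁻¹ * |x i| ^ (K.a + 1)

theorem SolvesAt.hasDerivAt_energy {S : Plant n ι κ} {K : Gains n κ} {μm μM : ℝ}
    {qd : Fin n → ℝ} {x v : ℝ → Fin n → ℝ} {t : ℝ} (h : SolvesAt S K qd x v t)
    (hS : S.Standing μm μM) (ha : 0 < K.a) (hb : 0 < K.b) :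
    HasDerivAt (fun s => energy S K qd (x s) (v s))
      (-∑ i, (K.d i * |v t i| ^ (K.b + 1) + K.dL i * v t i ^ 2)) t := by
  have h1 : HasDerivAt (fun s => ∑ i, v s i * (S.M (x s + qd) *ᵥ v s) i)
      (∑ i, (accel S K qd (x t) (v t) 0 i * (S.M (x t + qd) *ᵥ v t) i + v t i *
        ((S.C (x t + qd) (v t))ᵀ *ᵥ v t + pdForce K (x t) (v t)) i)) t :=
    HasDerivAt.fun_sum fun i _ => (hasDerivAt_pi.1 h.vel i).mul (h.hasDerivAt_momentum hS i)
  have h2 : HasDerivAt (fun s => ∑ i, K.p i * (K.a + 1)⁻¹ * |x s i| ^ (K.a + 1))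
      (∑ i, K.p i * (K.a + 1)⁻¹ * (((K.a + 1) * spow K.a (x t i)) * v t i)) t :=
    HasDerivAt.fun_sum fun i _ =>
      ((hasDerivAt_abs_rpow_add_one ha (x t i)).comp t (hasDerivAt_pi.1 h.pos i)).const_mul _
  refine ((h1.const_mul 2⁻¹).add h2).congr_deriv ?_
  -- Symmetry of `M` moves it onto the acceleration; with `h4`, the Coriolis terms then do no work.
  have h3 : accel S K qd (x t) (v t) 0 ⬝ᵥ S.M (x t + qd) *ᵥ v t =
      v t ⬝ᵥ (pdForce K (x t) (v t) - S.C (x t + qd) (v t) *ᵥ v t) := by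
    rw [← hS.M_mulVec_accel, Matrix.dotProduct_mulVec, ← Matrix.mulVec_transpose,
      (hS.M_symm _).eq, dotProduct_comm]
  have h4 : v t ⬝ᵥ (S.C (x t + qd) (v t))ᵀ *ᵥ v t = v t ⬝ᵥ S.C (x t + qd) (v t) *ᵥ v t := by
    rw [Matrix.mulVec_transpose, dotProduct_comm, ← Matrix.dotProduct_mulVec]
  rw [Finset.sum_add_distrib]
  change 2⁻¹ * (accel S K qd (x t) (v t) 0 ⬝ᵥ S.M (x t + qd) *ᵥ v t + v t ⬝ᵥ
        ((S.C (x t + qd) (v t))ᵀ *ᵥ v t + pdForce K (x t) (v t))) + _ = _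
  rw [h3, dotProduct_sub, dotProduct_add, h4]
  have h5 : v t ⬝ᵥ pdForce K (x t) (v t) + ∑ i, K.p i * (K.a + 1)⁻¹ *
      (((K.a + 1) * spow K.a (x t i)) * v t i) =
      -∑ i, (K.d i * |v t i| ^ (K.b + 1) + K.dL i * v t i ^ 2) := by
    rw [dotProduct, ← Finset.sum_add_distrib, ← Finset.sum_neg_distrib]
    refine Finset.sum_congr rfl fun i _ => ?_
    rw [← mul_spow_self hb, pdForce]
    field_simp
    ring
  linarith

/-- The term `x ⬝ᵥ pdForce` provides the decay in position that the energy balance lacks. -/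
theorem SolvesAt.hasDerivAt_cross {S : Plant n ι κ} {K : Gains n κ} {μm μM : ℝ}
    {qd : Fin n → ℝ} {x v : ℝ → Fin n → ℝ} {t : ℝ} (h : SolvesAt S K qd x v t)
    (hS : S.Standing μm μM) :
    HasDerivAt (fun s => x s ⬝ᵥ S.M (x s + qd) *ᵥ v s)
      (v t ⬝ᵥ S.M (x t + qd) *ᵥ v t + x t ⬝ᵥ (S.C (x t + qd) (v t))ᵀ *ᵥ v t +
        x t ⬝ᵥ pdForce K (x t) (v t)) t := by
  have h1 : HasDerivAt (fun s => ∑ i, x s i * (S.M (x s + qd) *ᵥ v s) i)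
      (∑ i, (v t i * (S.M (x t + qd) *ᵥ v t) i + x t i *
        ((S.C (x t + qd) (v t))ᵀ *ᵥ v t + pdForce K (x t) (v t)) i)) t :=
    HasDerivAt.fun_sum fun i _ => (hasDerivAt_pi.1 h.pos i).mul (h.hasDerivAt_momentum hS i)
  refine h1.congr_deriv ?_
  rw [Finset.sum_add_distrib, add_assoc, ← dotProduct_add]
  rfl

/-! ### Lyapunov estimates -/

namespace Gains.Admissible

variable {K : Gains n κ} (hK : K.Admissible)
include hK

theorem mc_pos : 0 < K.mc := by
  have := hK.r₁_lt
  rw [Gains.mc]; linarith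

theorem r₁_pos : 0 < K.r₁ := hK.r₂_pos.trans hK.r₂_lt_r₁

theorem a_pos : 0 < K.a := div_pos hK.mc_pos hK.r₁_pos

theorem b_pos : 0 < K.b := div_pos hK.mc_pos hK.r₂_pos

theorem b_lt_one : K.b < 1 := by
  rw [Gains.b, div_lt_one hK.r₂_pos, Gains.mc]
  linarith [hK.r₂_lt_r₁]

/-- Since `b / a = r₁ / r₂`, the remainder in `exists_mul_rpow_le` is exactly quadratic in the
velocity. -/
theorem b_div_a_add_b : K.b / K.a + K.b = 2 := by
  have h := hK.mc_pos.ne'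
  have h1 := hK.r₁_pos.ne'
  have h2 := hK.r₂_pos.ne'
  rw [Gains.a, Gains.b]
  field_simp
  rw [Gains.mc]; ring

/-- Both sides equal `(r₁ + r₂) / (2 r₂)`: this matches the degree of the cross term to that of `E ^
s`. -/
theorem inv_a_add_one_add_half : (K.a + 1)⁻¹ + 2⁻¹ = 1 + (1 - K.b) / 2 := by
  have h1 := hK.r₁_pos.ne'
  have h2 := hK.r₂_pos.ne'
  have h3 : K.a + 1 = 2 * K.r₂ / K.r₁ := by
    rw [Gains.a, Gains.mc]; field_simp; ring
  rw [h3, Gains.b, Gains.mc]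
  field_simp
  ring

end Gains.Admissible

theorem exists_pos_forall_le {f : Fin n → ℝ} (hf : ∀ i, 0 < f i) :
    ∃ m, 0 < m ∧ ∀ i, m ≤ f i := by
  cases isEmpty_or_nonempty (Fin n) with
  | inl h => exact ⟨1, one_pos, fun i => h.elim i⟩
  | inr h =>
    obtain ⟨i, hi⟩ := Finite.exists_min f
    exact ⟨f i, hf i, hi⟩

theorem sq_le_dotProduct_self (v : Fin n → ℝ) (i : Fin n) : v i ^ 2 ≤ v ⬝ᵥ v := by
  rw [sq]
  exact Finset.single_le_sum (f := fun i => v i * v i) (fun j _ => mul_self_nonneg (v j))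
    (Finset.mem_univ i)

theorem abs_mul_abs_le_dotProduct_self (v : Fin n → ℝ) (i j : Fin n) :
    |v i| * |v j| ≤ v ⬝ᵥ v := by
  have h1 := sq_le_dotProduct_self v i
  have h2 := sq_le_dotProduct_self v j
  rw [← sq_abs] at h1 h2
  nlinarith [sq_nonneg (|v i| - |v j|)]

theorem abs_sum_le_card_mul {f : Fin n → ℝ} {B : ℝ} (h : ∀ i, |f i| ≤ B) :
    |∑ i, f i| ≤ n * B := by
  refine (Finset.abs_sum_le_sum_abs _ _).trans ((Finset.sum_le_sum fun i _ => h i).trans ?_)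
  simp

/-- The derivatives of `M` are continuous but not assumed bounded, so compactness of a box is used.
-/
theorem Plant.Standing.exists_bound {S : Plant n ι κ} {μm μM : ℝ} (hS : S.Standing μm μM)
    (qd : Fin n → ℝ) (R : ℝ) :
    ∃ B, 0 ≤ B ∧ ∀ x : Fin n → ℝ, (∀ i, |x i| ≤ R) →
      (∀ i j, |S.M (x + qd) i j| ≤ B) ∧ ∀ i j k, |S.christoffel i j k (x + qd)| ≤ B := by
  have hc : IsCompact (Set.univ.pi fun _ : Fin n => Set.Icc (-R) R) :=
    isCompact_univ_pi fun _ => isCompact_Icc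
  have hadd : Continuous fun x : Fin n → ℝ => x + qd := by fun_prop
  have h1 : ∀ i j, ∃ B, ∀ x ∈ Set.univ.pi fun _ : Fin n => Set.Icc (-R) R,
      ‖S.M (x + qd) i j‖ ≤ B := fun i j =>
    hc.exists_bound_of_continuousOn ((hS.contDiff_M i j).continuous.comp hadd).continuousOn
  have h2 : ∀ i j k, ∃ B, ∀ x ∈ Set.univ.pi fun _ : Fin n => Set.Icc (-R) R,
      ‖S.christoffel i j k (x + qd)‖ ≤ B := fun i j k =>
    hc.exists_bound_of_continuousOn ((hS.continuous_christoffel i j k).comp hadd).continuousOn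
  choose B₁ hB₁ using h1
  choose B₂ hB₂ using h2
  have hs1 : 0 ≤ ∑ i, ∑ j, |B₁ i j| := by positivity
  have hs2 : 0 ≤ ∑ i, ∑ j, ∑ k, |B₂ i j k| := by positivity
  refine ⟨∑ i, ∑ j, |B₁ i j| + ∑ i, ∑ j, ∑ k, |B₂ i j k|, by positivity, fun x hx => ?_⟩
  have hmem : x ∈ Set.univ.pi fun _ : Fin n => Set.Icc (-R) R := fun i _ => abs_le.1 (hx i)
  constructor
  · intro i j
    have h3 : |B₁ i j| ≤ ∑ j, |B₁ i j| :=
      Finset.single_le_sum (f := fun j => |B₁ i j|) (fun _ _ => abs_nonneg _) (Finset.mem_univ j)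
    have h4 : ∑ j, |B₁ i j| ≤ ∑ i, ∑ j, |B₁ i j| :=
      Finset.single_le_sum (f := fun i => ∑ j, |B₁ i j|) (fun _ _ => by positivity)
        (Finset.mem_univ i)
    have h5 := (hB₁ i j x hmem).trans (le_abs_self _)
    rw [Real.norm_eq_abs] at h5
    linarith
  · intro i j k
    have h2' : |B₂ i j k| ≤ ∑ k, |B₂ i j k| :=
      Finset.single_le_sum (f := fun k => |B₂ i j k|) (fun _ _ => abs_nonneg _)
        (Finset.mem_univ k)
    have h3 : ∑ k, |B₂ i j k| ≤ ∑ j, ∑ k, |B₂ i j k| :=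
      Finset.single_le_sum (f := fun j => ∑ k, |B₂ i j k|) (fun _ _ => by positivity)
        (Finset.mem_univ j)
    have h4 : ∑ j, ∑ k, |B₂ i j k| ≤ ∑ i, ∑ j, ∑ k, |B₂ i j k| :=
      Finset.single_le_sum (f := fun i => ∑ j, ∑ k, |B₂ i j k|) (fun _ _ => by positivity)
        (Finset.mem_univ i)
    have h5 := (hB₂ i j k x hmem).trans (le_abs_self _)
    rw [Real.norm_eq_abs] at h5
    linarith

theorem abs_dotProduct_C_transpose_le {S : Plant n ι κ} {q x v : Fin n → ℝ} {B R : ℝ}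
    (hB : ∀ i j k, |S.christoffel i j k q| ≤ B) (hR : ∀ i, |x i| ≤ R) :
    |x ⬝ᵥ (S.C q v)ᵀ *ᵥ v| ≤ n * (n * (n * (R * B))) * (v ⬝ᵥ v) := by
  have h : x ⬝ᵥ (S.C q v)ᵀ *ᵥ v =
      ∑ k, ∑ j, ∑ i, x k * S.christoffel i k j q * (v i * v j) := by
    simp only [dotProduct, Matrix.mulVec, Matrix.transpose_apply, Plant.C, Matrix.of_apply,
      Finset.mul_sum, Finset.sum_mul]
    refine Finset.sum_congr rfl fun k _ => Finset.sum_congr rfl fun j _ =>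
      Finset.sum_congr rfl fun i _ => ?_
    ring
  rw [h]
  refine (abs_sum_le_card_mul fun k => abs_sum_le_card_mul fun j => abs_sum_le_card_mul
    (B := R * B * (v ⬝ᵥ v)) fun i => ?_).trans_eq (by ring)
  rw [abs_mul, abs_mul, abs_mul (v i)]
  have hR0 : 0 ≤ R := (abs_nonneg _).trans (hR k)
  exact mul_le_mul (mul_le_mul (hR k) (hB i k j) (abs_nonneg _) hR0)
    (abs_mul_abs_le_dotProduct_self v i j) (by positivity)
    (mul_nonneg hR0 ((abs_nonneg _).trans (hB i k j)))

theorem abs_dotProduct_mulVec_le {A : Matrix (Fin n) (Fin n) ℝ} {x v : Fin n → ℝ} {B Z : ℝ}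
    (hB : ∀ i j, |A i j| ≤ B) (hZ : ∀ i j, |x i| * |v j| ≤ Z) :
    |x ⬝ᵥ A *ᵥ v| ≤ n * (n * B) * Z := by
  have h : x ⬝ᵥ A *ᵥ v = ∑ i, ∑ j, A i j * (x i * v j) := by
    simp only [dotProduct, Matrix.mulVec, Finset.mul_sum]
    refine Finset.sum_congr rfl fun i _ => Finset.sum_congr rfl fun j _ => ?_
    ring
  rw [h]
  refine (abs_sum_le_card_mul fun i => abs_sum_le_card_mul (B := B * Z) fun j => ?_).trans_eq
    (by ring)
  rw [abs_mul, abs_mul (x i)]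
  exact mul_le_mul (hB i j) (hZ i j) (by positivity) ((abs_nonneg _).trans (hB i j))

/-- On bounded velocities the proportional action dominates the damping in `x ⬝ᵥ pdForce`. -/
theorem exists_dotProduct_pdForce_le {K : Gains n κ} (hK : K.Admissible) {W : ℝ} (hW : 0 ≤ W) :
    ∃ C, 0 ≤ C ∧ ∀ x v : Fin n → ℝ, (∀ i, |v i| ≤ W) →
      x ⬝ᵥ pdForce K x v ≤ C * (v ⬝ᵥ v) - 2⁻¹ * ∑ i, K.p i * |x i| ^ (K.a + 1) := by
  have ha := hK.a_pos
  have hb := hK.b_pos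
  -- For `|v| ≤ W`, linear damping is at most `W ^ (1 - b)` times the sublinear one, so one
  -- coefficient serves both. Taking `η = p / 2` keeps half of the proportional term.
  have hK0 : ∀ i, 0 ≤ K.d i + K.dL i * W ^ (1 - K.b) := fun i =>
    add_nonneg (hK.d_pos i).le (mul_nonneg (hK.dL_pos i).le (Real.rpow_nonneg hW _))
  choose C hC0 hC using fun i =>
    exists_mul_rpow_le (b := K.b) ha (K.d i + K.dL i * W ^ (1 - K.b)) (hK0 i)
      (half_pos (hK.p_pos i))
  refine ⟨∑ i, C i, Finset.sum_nonneg fun i _ => hC0 i, fun x v hv => ?_⟩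
  rw [Finset.sum_mul, Finset.mul_sum, ← Finset.sum_sub_distrib]
  refine Finset.sum_le_sum fun i _ => ?_
  have h1 := hC i |x i| |v i| (abs_nonneg _) (abs_nonneg _)
  have h2 : |v i| ^ (K.b / K.a) * |v i| ^ K.b = v i ^ 2 := by
    rw [← Real.rpow_add_of_nonneg (abs_nonneg _) (div_pos hb ha).le hb.le, hK.b_div_a_add_b,
      Real.rpow_two, sq_abs]
  rw [h2] at h1
  have h3 : |v i| ≤ W ^ (1 - K.b) * |v i| ^ K.b := by
    have h4 : |v i| ^ (1 - K.b) * |v i| ^ K.b = |v i| := by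
      rw [← Real.rpow_add_of_nonneg (abs_nonneg _) (by linarith [hK.b_lt_one]) hb.le]
      simp
    have h5 := Real.rpow_le_rpow (abs_nonneg _) (hv i) (by linarith [hK.b_lt_one] : 0 ≤ 1 - K.b)
    calc |v i| = |v i| ^ (1 - K.b) * |v i| ^ K.b := h4.symm
      _ ≤ _ := mul_le_mul_of_nonneg_right h5 (Real.rpow_nonneg (abs_nonneg _) _)
  have h6 : -(x i * spow K.b (v i)) ≤ |x i| * |v i| ^ K.b := by
    rw [← abs_spow hb, ← abs_mul]; exact neg_le_abs _
  have h7 : -(x i * v i) ≤ |x i| * (W ^ (1 - K.b) * |v i| ^ K.b) := by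
    refine (neg_le_abs _).trans ?_
    rw [abs_mul]
    exact mul_le_mul_of_nonneg_left h3 (abs_nonneg _)
  have h8 := mul_le_mul_of_nonneg_left h6 (hK.d_pos i).le
  have h9 := mul_le_mul_of_nonneg_left h7 (hK.dL_pos i).le
  have h10 := mul_le_mul_of_nonneg_left (sq_le_dotProduct_self v i) (hC0 i)
  have h11 : x i * pdForce K x v i = -(K.p i * |x i| ^ (K.a + 1)) +
      K.d i * -(x i * spow K.b (v i)) + K.dL i * -(x i * v i) := by
    rw [← mul_spow_self ha, pdForce]; ring
  rw [h11]; linarith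

theorem energy_bounds {S : Plant n ι κ} {K : Gains n κ} {μm μM : ℝ}
    (hS : S.Standing μm μM) (hK : K.Admissible) (qd x v : Fin n → ℝ) :
    2⁻¹ * μm * (v ⬝ᵥ v) + (K.a + 1)⁻¹ * ∑ i, K.p i * |x i| ^ (K.a + 1) ≤ energy S K qd x v ∧
      energy S K qd x v ≤ μM * (v ⬝ᵥ v) + ∑ i, K.p i * |x i| ^ (K.a + 1) := by
  have h1 := hS.M_lower (x + qd) v
  have h2 := hS.M_upper (x + qd) v
  have h3 : ∑ i, K.p i * (K.a + 1)⁻¹ * |x i| ^ (K.a + 1) =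
      (K.a + 1)⁻¹ * ∑ i, K.p i * |x i| ^ (K.a + 1) := by
    rw [Finset.mul_sum]
    exact Finset.sum_congr rfl fun i _ => by ring
  have hY : 0 ≤ ∑ i, K.p i * |x i| ^ (K.a + 1) := Finset.sum_nonneg fun i _ =>
    mul_nonneg (hK.p_pos i).le (Real.rpow_nonneg (abs_nonneg _) _)
  have hN : 0 ≤ v ⬝ᵥ v := Finset.sum_nonneg fun i _ => mul_self_nonneg (v i)
  have h4 : (K.a + 1)⁻¹ ≤ 1 := inv_le_one_of_one_le₀ (by linarith [hK.a_pos])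
  have h5 := mul_le_mul_of_nonneg_right h4 hY
  have h6 := mul_nonneg hS.μM_pos.le hN
  rw [energy, h3]
  constructor <;> linarith

theorem exists_energy_coercive {S : Plant n ι κ} {K : Gains n κ} {μm μM : ℝ}
    (hS : S.Standing μm μM) (hK : K.Admissible) (qd : Fin n → ℝ) :
    ∃ m, 0 < m ∧ ∀ x v : Fin n → ℝ, 0 ≤ energy S K qd x v ∧
      ∀ i, m * |x i| ^ (K.a + 1) ≤ energy S K qd x v ∧ m * v i ^ 2 ≤ energy S K qd x v := by
  have ha : 0 < (K.a + 1)⁻¹ := inv_pos.2 (by linarith [hK.a_pos])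
  obtain ⟨p, hp, hpK⟩ := exists_pos_forall_le hK.p_pos
  refine ⟨min (2⁻¹ * μm) ((K.a + 1)⁻¹ * p), lt_min (by linarith [hS.μm_pos]) (by positivity),
    fun x v => ?_⟩
  have hE := (energy_bounds hS hK qd x v).1
  have hx : ∀ i, 0 ≤ |x i| ^ (K.a + 1) := fun i => Real.rpow_nonneg (abs_nonneg _) _
  have hY : 0 ≤ ∑ i, K.p i * |x i| ^ (K.a + 1) := Finset.sum_nonneg fun i _ =>
    mul_nonneg (hK.p_pos i).le (hx i)
  have hN : 0 ≤ v ⬝ᵥ v := Finset.sum_nonneg fun i _ => mul_self_nonneg (v i)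
  have h1 := mul_nonneg ha.le hY
  have h2 : 0 ≤ 2⁻¹ * μm * (v ⬝ᵥ v) := mul_nonneg (by linarith [hS.μm_pos]) hN
  refine ⟨by linarith, fun i => ⟨?_, ?_⟩⟩
  · have h3 : p * |x i| ^ (K.a + 1) ≤ ∑ i, K.p i * |x i| ^ (K.a + 1) :=
      (mul_le_mul_of_nonneg_right (hpK i) (hx i)).trans
        (Finset.single_le_sum (f := fun i => K.p i * |x i| ^ (K.a + 1))
          (fun j _ => mul_nonneg (hK.p_pos j).le (hx j)) (Finset.mem_univ i))
    have h4 := mul_le_mul_of_nonneg_right (min_le_right (2⁻¹ * μm) ((K.a + 1)⁻¹ * p)) (hx i)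
    have h5 := mul_le_mul_of_nonneg_left h3 ha.le
    linarith
  · have h4 := mul_le_mul_of_nonneg_right (min_le_left (2⁻¹ * μm) ((K.a + 1)⁻¹ * p))
      (sq_nonneg (v i))
    have h5 := mul_le_mul_of_nonneg_left (sq_le_dotProduct_self v i)
      (by linarith [hS.μm_pos] : 0 ≤ 2⁻¹ * μm)
    linarith

/-- On a sublevel set of the energy `E`, the function `E ^ s + ε x ⬝ᵥ M v` is comparable to `E ^ s`,
and the bound on its derivative along the trajectories is a negative multiple of `E`. -/
theorem exists_lyapunov_constants {S : Plant n ι κ} {K : Gains n κ} {μm μM : ℝ}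
    (hS : S.Standing μm μM) (hK : K.Admissible) (qd : Fin n → ℝ) {s : ℝ}
    (hs : s = 1 + (1 - K.b) / 2) (E₀ : ℝ) :
    ∃ ε c, 0 < c ∧ ∀ x v : Fin n → ℝ, energy S K qd x v ≤ E₀ →
      |ε * (x ⬝ᵥ S.M (x + qd) *ᵥ v)| ≤ 2⁻¹ * energy S K qd x v ^ s ∧
      (-∑ i, (K.d i * |v i| ^ (K.b + 1) + K.dL i * v i ^ 2)) * s * energy S K qd x v ^ (s - 1) +
        ε * (v ⬝ᵥ S.M (x + qd) *ᵥ v + x ⬝ᵥ (S.C (x + qd) v)ᵀ *ᵥ v + x ⬝ᵥ pdForce K x v) ≤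
        -(c * energy S K qd x v) := by
  have ha := hK.a_pos
  have hb := hK.b_pos
  have hb1 := hK.b_lt_one
  have hs1 : 1 < s := by linarith
  obtain ⟨m, hm, hcoer⟩ := exists_energy_coercive hS hK qd
  obtain ⟨d, hd, hdK⟩ := exists_pos_forall_le hK.d_pos
  obtain ⟨B, hB, hbound⟩ := hS.exists_bound qd ((E₀ / m) ^ (K.a + 1)⁻¹)
  obtain ⟨C, hC, hpd⟩ := exists_dotProduct_pdForce_le hK (Real.sqrt_nonneg (E₀ / m))
  set R := (E₀ / m) ^ (K.a + 1)⁻¹ with hR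
  set k₁ := s * d * m ^ (s - 1) with hk₁
  -- `k₁` measures the dissipation gained, `k₂` the quadratic velocity terms produced by the cross
  -- term, `k₃` its size relative to `E ^ s`. The absolute value of `R` keeps `k₂` nonnegative
  -- without a sign condition on `E₀`.
  set k₂ := μM + n * (n * (n * (|R| * B))) + C with hk₂
  set k₃ := n * (n * B) * (m⁻¹) ^ s with hk₃
  have hk₁0 : 0 < k₁ := by positivity
  have hk₂0 : 0 ≤ k₂ := by have := hS.μM_pos; positivity
  have hk₃0 : 0 ≤ k₃ := by positivity
  -- The first bound spends at most half of the dissipation, the second makes the cross term at most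
  -- half of `E ^ s`.
  set ε := min (k₁ / (2 * (k₂ + 1))) (1 / (2 * (k₃ + 1))) with hε
  have hε0 : 0 < ε := by positivity
  have hε1 : ε * k₂ ≤ k₁ / 2 := by
    have h := min_le_left (k₁ / (2 * (k₂ + 1))) (1 / (2 * (k₃ + 1)))
    rw [← hε, le_div_iff₀ (by positivity)] at h
    nlinarith
  have hε2 : ε * k₃ ≤ 2⁻¹ := by
    have h := min_le_right (k₁ / (2 * (k₂ + 1))) (1 / (2 * (k₃ + 1)))
    rw [← hε, le_div_iff₀ (by positivity)] at h
    nlinarith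
  have hμM := hS.μM_pos
  -- What remains is `-(k₁ / 2) N - (ε / 2) Y`, with `N = v ⬝ᵥ v` and `Y` the weighted sum of `|x i|
  -- ^ (a + 1)`; it is compared with `E ≤ μM N + Y`.
  refine ⟨ε, min (k₁ / (2 * μM)) (ε / 2), by positivity, fun x v hE => ?_⟩
  obtain ⟨hE0, hxv⟩ := hcoer x v
  have hEb := (energy_bounds hS hK qd x v).2
  set E := energy S K qd x v with hEdef
  have hEm : 0 ≤ E / m := div_nonneg hE0 hm.le
  have hEE : E / m ≤ E₀ / m := div_le_div_of_nonneg_right hE hm.le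
  have hxR : ∀ i, |x i| ≤ R := fun i => by
    have h : |x i| ^ (K.a + 1) ≤ E₀ / m := by
      refine le_trans ?_ hEE
      rw [le_div_iff₀ hm]; linarith [(hxv i).1]
    have h1 := Real.rpow_le_rpow (by positivity) h (by positivity : 0 ≤ (K.a + 1)⁻¹)
    rwa [Real.rpow_rpow_inv (abs_nonneg _) (by linarith)] at h1
  have hvW : ∀ i, |v i| ≤ √(E₀ / m) := fun i => by
    rw [← Real.sqrt_sq_eq_abs]
    refine Real.sqrt_le_sqrt (le_trans ?_ hEE)
    rw [le_div_iff₀ hm]; linarith [(hxv i).2]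
  obtain ⟨hBM, hBC⟩ := hbound x hxR
  constructor
  · have h1 : ∀ i j, |x i| * |v j| ≤ (m⁻¹) ^ s * E ^ s := fun i j => by
      have h := abs_mul_abs_le_rpow hm ha (hxv i).1 (hxv j).2
      rwa [hK.inv_a_add_one_add_half, ← hs, div_eq_inv_mul,
        Real.mul_rpow (by positivity) hE0] at h
    have h2 := abs_dotProduct_mulVec_le hBM h1
    rw [← mul_assoc, ← hk₃] at h2
    rw [abs_mul, abs_of_pos hε0]
    have h3 := mul_le_mul_of_nonneg_left h2 hε0.le
    have h4 := mul_le_mul_of_nonneg_right hε2 (Real.rpow_nonneg hE0 s)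
    linarith
  · have hN : 0 ≤ v ⬝ᵥ v := Finset.sum_nonneg fun i _ => mul_self_nonneg (v i)
    set N := v ⬝ᵥ v with hNdef
    set Y := ∑ i, K.p i * |x i| ^ (K.a + 1) with hYdef
    have hY : 0 ≤ Y := Finset.sum_nonneg fun i _ =>
      mul_nonneg (hK.p_pos i).le (Real.rpow_nonneg (abs_nonneg _) _)
    have hsb : (1 - K.b) / 2 = s - 1 := by linarith
    have hdiss : d * m ^ (s - 1) * N ≤
        (∑ i, (K.d i * |v i| ^ (K.b + 1) + K.dL i * v i ^ 2)) * E ^ (s - 1) := by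
      rw [hNdef, dotProduct, Finset.mul_sum, Finset.sum_mul]
      refine Finset.sum_le_sum fun i _ => ?_
      have h1 := rpow_mul_sq_le hm hb hb1 (hxv i).2
      rw [hsb] at h1
      have hEs := Real.rpow_nonneg hE0 (s - 1)
      have hv := Real.rpow_nonneg (abs_nonneg (v i)) (K.b + 1)
      have h2 := mul_le_mul_of_nonneg_left h1 hd.le
      have h3 := mul_le_mul_of_nonneg_right (hdK i) (mul_nonneg hEs hv)
      have h4 : 0 ≤ K.dL i * v i ^ 2 * E ^ (s - 1) :=
        mul_nonneg (mul_nonneg (hK.dL_pos i).le (sq_nonneg _)) hEs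
      linarith
    have hcross : v ⬝ᵥ S.M (x + qd) *ᵥ v + x ⬝ᵥ (S.C (x + qd) v)ᵀ *ᵥ v + x ⬝ᵥ pdForce K x v ≤
        k₂ * N - 2⁻¹ * Y := by
      have h1 := hS.M_upper (x + qd) v
      have h2 := (le_abs_self _).trans
        (abs_dotProduct_C_transpose_le (v := v) hBC fun i => (hxR i).trans (le_abs_self R))
      have h3 := hpd x v hvW
      rw [hk₂]
      linarith
    have h1 := mul_le_mul_of_nonneg_left hdiss (by linarith : 0 ≤ s)
    have h2 := mul_le_mul_of_nonneg_left hcross hε0.le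
    have h3 := mul_le_mul_of_nonneg_right hε1 hN
    have hc1 : min (k₁ / (2 * μM)) (ε / 2) * (μM * N) ≤ k₁ / 2 * N := by
      have h := mul_le_mul_of_nonneg_right (min_le_left (k₁ / (2 * μM)) (ε / 2))
        (mul_nonneg hμM.le hN)
      have h' : k₁ / (2 * μM) * (μM * N) = k₁ / 2 * N := by field_simp
      linarith
    have hc2 : min (k₁ / (2 * μM)) (ε / 2) * Y ≤ ε / 2 * Y :=
      mul_le_mul_of_nonneg_right (min_le_right _ _) hY
    have hc3 : min (k₁ / (2 * μM)) (ε / 2) * E ≤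
        min (k₁ / (2 * μM)) (ε / 2) * (μM * N + Y) :=
      mul_le_mul_of_nonneg_left hEb (by positivity)
    have h4 : s * (d * m ^ (s - 1) * N) = k₁ * N := by rw [hk₁]; ring
    linarith

/-! ### Finite-time stability -/

theorem exists_forall_ge_eq_zero_of_solvesAt {S : Plant n ι κ} {K : Gains n κ} {μm μM : ℝ}
    (hS : S.Standing μm μM) (hK : K.Admissible) {qd : Fin n → ℝ} {x v : ℝ → Fin n → ℝ} {T₀ : ℝ}
    (hx : ContinuousOn x (Set.Ici T₀)) (hv : ContinuousOn v (Set.Ici T₀))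
    (hsol : ∀ t, T₀ < t → SolvesAt S K qd x v t) :
    ∃ T₁, T₀ ≤ T₁ ∧ ∀ t, T₁ ≤ t → x t = 0 ∧ v t = 0 := by
  have ha := hK.a_pos
  have hb := hK.b_pos
  obtain ⟨s, hs⟩ : ∃ s, s = 1 + (1 - K.b) / 2 := ⟨_, rfl⟩
  have hs1 : 1 < s := by linarith [hK.b_lt_one]
  have hx' := continuousOn_pi.1 hx
  have hv' := continuousOn_pi.1 hv
  have hMc : ∀ i j, ContinuousOn (fun t => S.M (x t + qd) i j) (Set.Ici T₀) := fun i j =>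
    (hS.contDiff_M i j).continuous.comp_continuousOn (hx.add continuousOn_const)
  have hquad : ∀ y : ℝ → Fin n → ℝ, ContinuousOn y (Set.Ici T₀) →
      ContinuousOn (fun t => y t ⬝ᵥ S.M (x t + qd) *ᵥ v t) (Set.Ici T₀) := fun y hy => by
    simp only [dotProduct, Matrix.mulVec]
    exact continuousOn_finsetSum _ fun i _ => (continuousOn_pi.1 hy i).mul
      (continuousOn_finsetSum _ fun j _ => (hMc i j).mul (hv' j))
  have hEc : ContinuousOn (fun t => energy S K qd (x t) (v t)) (Set.Ici T₀) :=
    (continuousOn_const.mul (hquad v hv)).add (continuousOn_finsetSum _ fun i _ =>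
      continuousOn_const.mul ((hx' i).abs.rpow_const fun _ _ => Or.inr (by linarith)))
  have hEd := fun t ht => (hsol t ht).hasDerivAt_energy hS ha hb
  have hEanti := antitoneOn_Ici_of_hasDerivAt_nonpos hEc hEd fun t _ => by
    refine neg_nonpos.2 (Finset.sum_nonneg fun i _ => add_nonneg ?_ ?_)
    · exact mul_nonneg (hK.d_pos i).le (Real.rpow_nonneg (abs_nonneg _) _)
    · exact mul_nonneg (hK.dL_pos i).le (sq_nonneg _)
  obtain ⟨m, hm, hcoer⟩ := exists_energy_coercive hS hK qd
  obtain ⟨ε, c, hc, hlyap⟩ := exists_lyapunov_constants hS hK qd hs (energy S K qd (x T₀) (v T₀))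
  have hE0 : ∀ t, T₀ ≤ t → energy S K qd (x t) (v t) ≤ energy S K qd (x T₀) (v T₀) :=
    fun t ht => hEanti (Set.mem_Ici.2 le_rfl) (Set.mem_Ici.2 ht) ht
  have hV : ∀ t, T₀ ≤ t → 2⁻¹ * energy S K qd (x t) (v t) ^ s ≤
      energy S K qd (x t) (v t) ^ s + ε * (x t ⬝ᵥ S.M (x t + qd) *ᵥ v t) ∧
      energy S K qd (x t) (v t) ^ s + ε * (x t ⬝ᵥ S.M (x t + qd) *ᵥ v t) ≤
      2 * energy S K qd (x t) (v t) ^ s := fun t ht => by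
    have h1 := abs_le.1 (hlyap _ _ (hE0 t ht)).1
    have h2 := Real.rpow_nonneg (hcoer (x t) (v t)).1 s
    constructor <;> linarith [h1.1, h1.2]
  -- From `V ≤ 2 E ^ s` comes `E ≥ (V / 2) ^ (1 / s)`, whence the constant and exponent. Since `s >
  -- 1`, `E ^ s` is differentiable even where `E = 0`.
  obtain ⟨T₁, hT, hzero⟩ := exists_forall_ge_eq_zero_of_deriv_le_neg_rpow
    (V := fun t => energy S K qd (x t) (v t) ^ s + ε * (x t ⬝ᵥ S.M (x t + qd) *ᵥ v t))
    (T₀ := T₀) (c := c * (2⁻¹) ^ s⁻¹) (α := s⁻¹) (by positivity) (inv_lt_one_of_one_lt₀ hs1)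
    ((hEc.rpow_const fun _ _ => Or.inr (by linarith)).add (continuousOn_const.mul (hquad x hx)))
    (fun t ht => ((hEd t ht).rpow_const (p := s) (Or.inr hs1.le)).add
      (((hsol t ht).hasDerivAt_cross hS).const_mul ε))
    (fun t ht => le_trans
      (mul_nonneg (by norm_num) (Real.rpow_nonneg (hcoer (x t) (v t)).1 s)) (hV t ht).1)
    (fun t ht => by
      refine (hlyap _ _ (hE0 t ht.le)).2.trans (neg_le_neg ?_)
      rw [mul_assoc]
      refine mul_le_mul_of_nonneg_left ?_ hc.le
      have hE := (hcoer (x t) (v t)).1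
      have h0 := le_trans
        (mul_nonneg (by norm_num) (Real.rpow_nonneg (hcoer (x t) (v t)).1 s)) (hV t ht.le).1
      rw [← Real.mul_rpow (by norm_num) h0]
      have h1 := (hV t ht.le).2
      calc _ ≤ (energy S K qd (x t) (v t) ^ s) ^ s⁻¹ :=
            Real.rpow_le_rpow (by positivity) (by linarith) (by positivity)
        _ = _ := Real.rpow_rpow_inv hE (by linarith))
  refine ⟨T₁, hT, fun t ht => ?_⟩
  obtain ⟨hE, hxv⟩ := hcoer (x t) (v t)
  have hEs : energy S K qd (x t) (v t) = 0 := by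
    have h1 := (hV t (hT.trans ht)).1
    rw [hzero t ht] at h1
    have h2 := Real.rpow_nonneg hE s
    have h3 : energy S K qd (x t) (v t) ^ s = 0 := le_antisymm (by linarith) h2
    exact (Real.rpow_eq_zero hE (by linarith)).1 h3
  rw [hEs] at hxv
  constructor <;> funext i
  · have h1 := (hxv i).1
    have h2 := Real.rpow_nonneg (abs_nonneg (x t i)) (K.a + 1)
    have h3 : |x t i| ^ (K.a + 1) = 0 := le_antisymm (by nlinarith) h2
    exact abs_eq_zero.1 ((Real.rpow_eq_zero (abs_nonneg _) (by linarith)).1 h3)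
  · have h1 := (hxv i).2
    exact pow_eq_zero_iff two_ne_zero |>.1 (le_antisymm (by nlinarith) (sq_nonneg (v t i)))

end FTPD

theorem corollary1 {n ι κ : ℕ} (S : FTPD.Plant n ι κ) (K : FTPD.Gains n κ) (μm μM : ℝ)
    (hS : S.Standing μm μM) (hK : K.Admissible)
    -- `d₁ ≤ λ_min(D_L) μm / μM²`, the diagonal of `D_L` being `K.dL`
    (hd₁ : ∀ i, K.d₁ ≤ K.dL i * μm / μM ^ 2)
    (qd : Fin n → ℝ) :
    -- the adaptive closed loop
    (∀ (Δ : ℝ → ℝ), ContinuousOn Δ (Set.Ici 0) →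
      ∀ (e₁ e₂ : ℝ → Fin n → ℝ) (θ : ℝ → Fin κ → ℝ),
        FTPD.IsClosedLoopSolution S K qd Δ e₁ e₂ θ →
        ∀ Tθ : ℝ, 0 < Tθ → (∀ t, Tθ ≤ t → S.Ψ (e₁ t + qd) *ᵥ θ t = 0) →
          ∃ Te : ℝ, Tθ ≤ Te ∧ ∀ t, Te ≤ t → e₁ t = 0 ∧ e₂ t = 0) ∧
    -- the closed loop with known parameters
    (∀ (e₁ e₂ : ℝ → Fin n → ℝ), FTPD.IsNominalSolution S K qd e₁ e₂ →
      ∃ Te : ℝ, 0 ≤ Te ∧ ∀ t, Te ≤ t → e₁ t = 0 ∧ e₂ t = 0) := by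
  constructor
  · intro Δ _ e₁ e₂ θ h Tθ hTθ hΨ
    have hsub : Set.Ici Tθ ⊆ Set.Ici 0 := Set.Ici_subset_Ici.2 hTθ.le
    refine FTPD.exists_forall_ge_eq_zero_of_solvesAt hS hK (qd := qd)
      (fun t ht => (h.deriv_e₁ t (hsub ht)).continuousWithinAt.mono hsub)
      (fun t ht => (h.deriv_e₂ t (hsub ht)).continuousWithinAt.mono hsub) fun t ht => ?_
    -- Strict positivity turns the one-sided derivatives on `[0, ∞)` into two-sided ones.
    have h0 : 0 < t := hTθ.trans ht
    have h2 := (h.deriv_e₂ t h0.le).hasDerivAt (Ici_mem_nhds h0)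
    rw [hΨ t ht.le] at h2
    exact ⟨(h.deriv_e₁ t h0.le).hasDerivAt (Ici_mem_nhds h0), h2⟩
  · intro e₁ e₂ h
    exact FTPD.exists_forall_ge_eq_zero_of_solvesAt hS hK (qd := qd)
      (fun t ht => (h.deriv_e₁ t ht).continuousWithinAt)
      (fun t ht => (h.deriv_e₂ t ht).continuousWithinAt) fun t ht =>
        ⟨(h.deriv_e₁ t ht.le).hasDerivAt (Ici_mem_nhds ht),
          (h.deriv_e₂ t ht.le).hasDerivAt (Ici_mem_nhds ht)⟩
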